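/- Throughout, an epimorphism of lattices is a surjective lattice homomorphism, $F(X)$ is the free lattice on the set $X$, and a sublattice is finitely generated if it is generated by a finite set using binary meets and joins. The fiber product of homomorphisms $g\colon A\to D$ and $h\colon B\to D$ is the sublattice $\{(a,b)\in A\times B : g(a)=h(b)\}$ of $A\times B$, and the kernel of $g$ is $\ker g=\{(a,b)\in A\times A : g(a)=g(b)\}$. A homomorphism $g\colon A\to D$ is lower (upper) bounded if for each $d\in D$ the set $\{x\in A : g(x)\ge d\}$ is empty or has a least element (respectively, $\{x\in A: g(x)\le d\}$ is empty or has a greatest element). A finitely generated lattice $D$ is lower (upper) bounded if there are a finite set $X$ and a lower (upper) bounded epimorphism $F(X)\to D$; it is bounded if it is both lower bounded and upper bounded. Let $D$ be a lattice with a finite generating set $P$ that satisfies Dean's condition (D): for all nonempty finite subsets $S,T\subseteq D$ with $\bigwedge S\le\bigvee T$, there is $s\in S$ with $s\le\bigvee T$, or there is $t\in T$ with $\bigwedge S\le t$, or there is $p\in P$ with $\bigwedge S\le p\le\bigvee T$. Then the following are equivalent: 1. $D$ is bounded. 2. There exist a finite set $X$ and an epimorphism $h\colon F(X)\to D$ such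 that $\ker h$ is a finitely generated sublattice of $F(X)\times F(X)$. 3. For every finitely generated lattice $A$ and every epimorphism $g\colon A\to D$, the kernel of $g$ is a finitely generated sublattice of $A\times A$. 4. For all finitely generated lattices $A,B$ and all epimorphisms $g\colon A\to D$ and $h\colon B\to D$, the fiber product of $g$ and $h$ is a finitely generated sublattice of $A\times B$. -/

import Mathlib

universe u v w

/-- Lattice terms over a set `X` of variables. -/
inductive LatticeTerm (X : Type u) : Type u
  | var (x : X) : LatticeTerm X
  | sup (s t : LatticeTerm X) : LatticeTerm X
  | inf (s t : LatticeTerm X) : LatticeTerm X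

namespace LatticeTerm

/-- `LE s t`: the inequality `s ≤ t` is derivable from the axioms of lattice order,
that is, `s ≤ t` holds in every lattice. -/
inductive LE {X : Type u} : LatticeTerm X → LatticeTerm X → Prop
  | refl (s : LatticeTerm X) : LE s s
  | trans {r s t : LatticeTerm X} : LE r s → LE s t → LE r t
  | le_sup_left (s t : LatticeTerm X) : LE s (sup s t)
  | le_sup_right (s t : LatticeTerm X) : LE t (sup s t)
  | sup_le {r s t : LatticeTerm X} : LE r t → LE s t → LE (sup r s) t
  | inf_le_left (s t : LatticeTerm X) : LE (inf s t) s
  | inf_le_right (s t : LatticeTerm X) : LE (inf s t) t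
  | le_inf {r s t : LatticeTerm X} : LE r s → LE r t → LE r (inf s t)

/-- Terms are identified when each is derivably below the other. -/
instance setoid (X : Type u) : Setoid (LatticeTerm X) where
  r s t := LE s t ∧ LE t s
  iseqv :=
    { refl := fun s => ⟨.refl s, .refl s⟩
      symm := fun h => ⟨h.2, h.1⟩
      trans := fun h k => ⟨h.1.trans k.1, k.2.trans h.2⟩ }

/-- Evaluation of a term in a lattice. -/
def eval {X : Type u} {L : Type v} [Lattice L] (f : X → L) : LatticeTerm X → L
  | var x => f x
  | sup s t => eval f s ⊔ eval f t
  | inf s t => eval f s ⊓ eval f t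

theorem LE.eval_le {X : Type u} {L : Type v} [Lattice L] (f : X → L) {s t : LatticeTerm X}
    (h : LE s t) : eval f s ≤ eval f t := by
  induction h with
  | refl s => exact le_rfl
  | trans _ _ ih₁ ih₂ => exact ih₁.trans ih₂
  | le_sup_left s t => exact _root_.le_sup_left
  | le_sup_right s t => exact _root_.le_sup_right
  | sup_le _ _ ih₁ ih₂ => exact _root_.sup_le ih₁ ih₂
  | inf_le_left s t => exact _root_.inf_le_left
  | inf_le_right s t => exact _root_.inf_le_right
  | le_inf _ _ ih₁ ih₂ => exact _root_.le_inf ih₁ ih₂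

end LatticeTerm

/-- The free lattice on `X`. -/
def FreeLattice (X : Type u) : Type u := Quotient (LatticeTerm.setoid X)

namespace FreeLattice

open LatticeTerm in
instance instLattice (X : Type u) : Lattice (FreeLattice X) where
  le := Quotient.lift₂ LE fun _ _ _ _ h k => propext
    ⟨fun l => (h.2.trans l).trans k.1, fun l => (h.1.trans l).trans k.2⟩
  le_refl := by rintro ⟨s⟩; exact LE.refl s
  le_trans := by rintro ⟨r⟩ ⟨s⟩ ⟨t⟩ h k; exact LE.trans h k
  le_antisymm := by rintro ⟨s⟩ ⟨t⟩ h k; exact Quotient.sound ⟨h, k⟩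
  sup := Quotient.map₂ LatticeTerm.sup fun _ _ h _ _ k =>
    ⟨.sup_le (h.1.trans (.le_sup_left _ _)) (k.1.trans (.le_sup_right _ _)),
      .sup_le (h.2.trans (.le_sup_left _ _)) (k.2.trans (.le_sup_right _ _))⟩
  le_sup_left := by rintro ⟨s⟩ ⟨t⟩; exact LE.le_sup_left s t
  le_sup_right := by rintro ⟨s⟩ ⟨t⟩; exact LE.le_sup_right s t
  sup_le := by rintro ⟨r⟩ ⟨s⟩ ⟨t⟩ h k; exact LE.sup_le h k
  inf := Quotient.map₂ LatticeTerm.inf fun _ _ h _ _ k =>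
    ⟨.le_inf (.trans (.inf_le_left _ _) h.1) (.trans (.inf_le_right _ _) k.1),
      .le_inf (.trans (.inf_le_left _ _) h.2) (.trans (.inf_le_right _ _) k.2)⟩
  inf_le_left := by rintro ⟨s⟩ ⟨t⟩; exact LE.inf_le_left s t
  inf_le_right := by rintro ⟨s⟩ ⟨t⟩; exact LE.inf_le_right s t
  le_inf := by rintro ⟨r⟩ ⟨s⟩ ⟨t⟩ h k; exact LE.le_inf h k

/-- The free generators. -/
def of {X : Type u} (x : X) : FreeLattice X :=
  Quotient.mk (LatticeTerm.setoid X) (LatticeTerm.var x)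

/-- The extension of a map `X → L` to a lattice homomorphism from the free lattice. -/
def lift {X : Type u} {L : Type v} [Lattice L] (f : X → L) : LatticeHom (FreeLattice X) L where
  toFun := Quotient.lift (LatticeTerm.eval f) fun _ _ h =>
    le_antisymm (h.1.eval_le f) (h.2.eval_le f)
  map_sup' := by rintro ⟨s⟩ ⟨t⟩; rfl
  map_inf' := by rintro ⟨s⟩ ⟨t⟩; rfl

theorem lift_of {X : Type u} {L : Type v} [Lattice L] (f : X → L) (x : X) :
    lift f (of x) = f x := rfl

theorem hom_ext {X : Type u} {L : Type v} [Lattice L] {f g : LatticeHom (FreeLattice X) L}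
    (h : ∀ x, f (of x) = g (of x)) : f = g := by
  refine LatticeHom.ext ?_
  rintro ⟨s⟩
  induction s with
  | var x => exact h x
  | sup s t hs ht =>
    have key : ∀ a b : FreeLattice X, f a = g a → f b = g b → f (a ⊔ b) = g (a ⊔ b) :=
      fun a b ha hb => by rw [map_sup, map_sup, ha, hb]
    exact key _ _ hs ht
  | inf s t hs ht =>
    have key : ∀ a b : FreeLattice X, f a = g a → f b = g b → f (a ⊓ b) = g (a ⊓ b) :=
      fun a b ha hb => by rw [map_inf, map_inf, ha, hb]
    exact key _ _ hs ht

end FreeLattice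

/-- `P` generates the lattice `L`. -/
def GeneratesLattice {L : Type u} [Lattice L] (P : Set L) : Prop :=
  latticeClosure P = Set.univ

/-- A lattice with a finite generating set. -/
def FGLattice (L : Type u) [Lattice L] : Prop :=
  ∃ P : Finset L, GeneratesLattice (P : Set L)

/-- A sublattice generated by a finite set. -/
def FGSublattice {L : Type u} [Lattice L] (C : Sublattice L) : Prop :=
  ∃ Z : Finset L, latticeClosure (Z : Set L) = (C : Set L)

/-- The fiber product (pullback) of two lattice homomorphisms. -/
def fiberProduct {A : Type u} {B : Type v} {D : Type w} [Lattice A] [Lattice B] [Lattice D]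
    (g : LatticeHom A D) (h : LatticeHom B D) : Sublattice (A × B) where
  carrier := {c | g c.1 = h c.2}
  supClosed' := by
    intro a ha b hb
    simp only [Set.mem_ofPred_eq] at ha hb ⊢
    rw [Prod.fst_sup, Prod.snd_sup, map_sup, map_sup, ha, hb]
  infClosed' := by
    intro a ha b hb
    simp only [Set.mem_ofPred_eq] at ha hb ⊢
    rw [Prod.fst_inf, Prod.snd_inf, map_inf, map_inf, ha, hb]

/-- The kernel of `g`, the set of pairs `(a, b)` with `g a = g b`, as a sublattice of `A × A`. -/
def latticeKer {A : Type u} {D : Type v} [Lattice A] [Lattice D] (g : LatticeHom A D) :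
    Sublattice (A × A) :=
  fiberProduct g g

/-- Each `{x | d ≤ g x}` is empty or has a least element. -/
def IsLowerBoundedHom {A : Type u} {D : Type v} [Lattice A] [Lattice D] (g : LatticeHom A D) :
    Prop :=
  ∀ d : D, {x | d ≤ g x} = ∅ ∨ ∃ a, IsLeast {x | d ≤ g x} a

/-- Each `{x | g x ≤ d}` is empty or has a greatest element. -/
def IsUpperBoundedHom {A : Type u} {D : Type v} [Lattice A] [Lattice D] (g : LatticeHom A D) :
    Prop :=
  ∀ d : D, {x | g x ≤ d} = ∅ ∨ ∃ a, IsGreatest {x | g x ≤ d} a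

/-- `D` is the image of a finitely generated free lattice under a lower bounded epimorphism. -/
def IsLowerBoundedLattice (D : Type u) [Lattice D] : Prop :=
  ∃ (X : Type) (_ : Finite X) (f : LatticeHom (FreeLattice X) D),
    Function.Surjective f ∧ IsLowerBoundedHom f

/-- `D` is the image of a finitely generated free lattice under an upper bounded epimorphism. -/
def IsUpperBoundedLattice (D : Type u) [Lattice D] : Prop :=
  ∃ (X : Type) (_ : Finite X) (f : LatticeHom (FreeLattice X) D),
    Function.Surjective f ∧ IsUpperBoundedHom f

/-- Bounded lattices in the sense of McKenzie (not: lattices with a least and a greatest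
element). -/
def IsBoundedLattice (D : Type u) [Lattice D] : Prop :=
  IsLowerBoundedLattice D ∧ IsUpperBoundedLattice D

/-- Dean's condition with respect to `P`. The sets `S`, `T` are nonempty, so that their meet
and join exist in every lattice. -/
def DeanCondition {D : Type u} [Lattice D] (P : Set D) : Prop :=
  ∀ (S T : Finset D) (hS : S.Nonempty) (hT : T.Nonempty),
    S.inf' hS id ≤ T.sup' hT id →
      (∃ s ∈ S, s ≤ T.sup' hT id) ∨ (∃ t ∈ T, S.inf' hS id ≤ t) ∨
        ∃ p ∈ P, S.inf' hS id ≤ p ∧ p ≤ T.sup' hT id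

open OrderDual

/-! ### Generation -/

/-! Free lattices satisfy Whitman's condition, which makes every homomorphism from a finitely
generated lattice into a free lattice lower and upper bounded
(`IsWhitmanLattice.isLowerBoundedHom`). The argument uses only `IsWhitmanLattice`, a self-dual
notion, so each upper statement is the lower one for the order dual.

Finite generation implies boundedness: let the fiber product of `g : A → D` and `h : B → D`, with
`A` and `B` free, be the image of a finitely generated free lattice. Its second projection into `B`
is bounded. If `w` is least with second coordinate above `b`, then the first coordinate of `w` is
least in `{x | h b ≤ g x}`. So `g` is lower bounded, and dually upper bounded.

Boundedness implies finite generation: `g` and `h` acquire lower adjoints `βg`, `βh` and upper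
adjoints `αg`, `αh`. If `g a = h b`, then `(a, b)` is the join of `(a, βh (g a))` and `(βg (h b),
b)`. It remains to generate these pairs from finitely many. Since `βh` preserves joins and `αh`
preserves meets, induction on `a` succeeds once `βh (g a)` can be traded for `αh (g a)` and back
(`rel_upper_and_rel_lower`). The trade uses the pairs `(βg d, αh d)` and `(αg d, βh d)`, and Dean's
condition generates these from finitely many (`PairDeanCondition.rel_lower_upper`). -/

theorem GeneratesLattice.induction {L : Type u} [Lattice L] {P : Set L} (hP : GeneratesLattice P)
    {p : L → Prop} (mem : ∀ a ∈ P, p a) (sup : ∀ a b, p a → p b → p (a ⊔ b))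
    (inf : ∀ a b, p a → p b → p (a ⊓ b)) (a : L) : p a :=
  latticeClosure_sup_inf_induction (s := P) (fun a _ => p a) mem
    (fun a _ b _ => sup a b) (fun a _ b _ => inf a b) (hP ▸ Set.mem_univ a)

theorem GeneratesLattice.of_induction {L : Type u} [Lattice L] {P : Set L}
    (h : ∀ p : L → Prop, (∀ a ∈ P, p a) → (∀ a b, p a → p b → p (a ⊔ b)) →
      (∀ a b, p a → p b → p (a ⊓ b)) → ∀ a, p a) : GeneratesLattice P :=
  Set.eq_univ_of_forall <| h (· ∈ latticeClosure P) (fun _ ha => subset_latticeClosure ha)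
    (fun _ _ ha hb => isSublattice_latticeClosure.supClosed ha hb)
    (fun _ _ ha hb => isSublattice_latticeClosure.infClosed ha hb)

theorem GeneratesLattice.dual {L : Type u} [Lattice L] {P : Set L} (hP : GeneratesLattice P) :
    GeneratesLattice (ofDual ⁻¹' P : Set Lᵒᵈ) :=
  .of_induction fun p mem sup inf =>
    hP.induction (p := fun a => p (toDual a)) (fun a ha => mem (toDual a) ha)
      (fun a b => inf (toDual a) (toDual b)) (fun a b => sup (toDual a) (toDual b))

theorem FGLattice.dual {L : Type u} [Lattice L] (h : FGLattice L) : FGLattice Lᵒᵈ := by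
  obtain ⟨P, hP⟩ := h
  refine ⟨P.map toDual.toEmbedding, ?_⟩
  convert hP.dual using 1
  ext a
  simp

namespace FreeLattice

theorem induction {X : Type u} {p : FreeLattice X → Prop} (of : ∀ x, p (of x))
    (sup : ∀ a b, p a → p b → p (a ⊔ b)) (inf : ∀ a b, p a → p b → p (a ⊓ b)) (a) : p a := by
  obtain ⟨t⟩ := a
  induction t with
  | var x => exact of x
  | sup s t hs ht => exact sup _ _ hs ht
  | inf s t hs ht => exact inf _ _ hs ht

theorem fgLattice (X : Type u) [Finite X] : FGLattice (FreeLattice X) := by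
  refine ⟨(Set.finite_range (of (X := X))).toFinset, .of_induction fun p mem => ?_⟩
  exact induction fun x => mem _ (by simp)

theorem mem_latticeClosure_iff_exists_lift {L : Type u} [Lattice L] {Z : Set L} {a : L} :
    a ∈ latticeClosure Z ↔ ∃ w, lift (Subtype.val : Z → L) w = a := by
  constructor
  · intro ha
    refine latticeClosure_sup_inf_induction (s := Z) (fun a _ => ∃ w, lift Subtype.val w = a)
      (fun a ha => ⟨of ⟨a, ha⟩, rfl⟩) ?_ ?_ ha
    · rintro _ _ _ _ ⟨v, rfl⟩ ⟨w, rfl⟩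
      exact ⟨v ⊔ w, map_sup _ _ _⟩
    · rintro _ _ _ _ ⟨v, rfl⟩ ⟨w, rfl⟩
      exact ⟨v ⊓ w, map_inf _ _ _⟩
  · rintro ⟨w, rfl⟩
    refine induction (p := fun w => lift Subtype.val w ∈ latticeClosure Z) ?_ ?_ ?_ w
    · exact fun x => subset_latticeClosure x.2
    · intro a b ha hb
      rw [map_sup]
      exact isSublattice_latticeClosure.supClosed ha hb
    · intro a b ha hb
      rw [map_inf]
      exact isSublattice_latticeClosure.infClosed ha hb

theorem lift_surjective {L : Type u} [Lattice L] {Z : Set L} (hZ : GeneratesLattice Z) :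
    Function.Surjective (lift (Subtype.val : Z → L)) := fun a =>
  mem_latticeClosure_iff_exists_lift.1 (hZ ▸ Set.mem_univ a)

end FreeLattice

/-! ### Whitman's condition for free lattices -/

/-- Day's doubling of the interval `[a, b]`: elements of the interval carry a free truth value,
elements outside it carry the truth value of `a ≤ x`. -/
def DoubledInterval {L : Type u} [Lattice L] (a b : L) : Type u :=
  {p : L × Prop // (p.2 → a ≤ p.1) ∧ (a ≤ p.1 → ¬ p.1 ≤ b → p.2)}

namespace DoubledInterval

variable {L : Type u} [Lattice L] {a b : L}

instance : PartialOrder (DoubledInterval a b) := inferInstanceAs (PartialOrder (Subtype _))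

/-- A join of two elements with value false can leave the interval upwards, where the value is
forced to be true; this is the third disjunct. Meets need no such correction. -/
instance : Lattice (DoubledInterval a b) where
  sup x y := ⟨(x.1.1 ⊔ y.1.1, x.1.2 ∨ y.1.2 ∨ (a ≤ x.1.1 ⊔ y.1.1 ∧ ¬ x.1.1 ⊔ y.1.1 ≤ b)), by
    rintro (h | h | h)
    exacts [(x.2.1 h).trans le_sup_left, (y.2.1 h).trans le_sup_right, h.1],
    fun h k => .inr (.inr ⟨h, k⟩)⟩
  inf x y := ⟨(x.1.1 ⊓ y.1.1, x.1.2 ∧ y.1.2), fun h => le_inf (x.2.1 h.1) (y.2.1 h.2),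
    fun h k => ⟨x.2.2 (h.trans inf_le_left) fun l => k (inf_le_left.trans l),
      y.2.2 (h.trans inf_le_right) fun l => k (inf_le_right.trans l)⟩⟩
  le_sup_left x y := ⟨le_sup_left, fun h => .inl h⟩
  le_sup_right x y := ⟨le_sup_right, fun h => .inr (.inl h)⟩
  sup_le x y z hx hy := ⟨sup_le hx.1 hy.1, by
    rintro (h | h | h)
    exacts [hx.2 h, hy.2 h,
      z.2.2 (h.1.trans (sup_le hx.1 hy.1)) fun l => h.2 ((sup_le hx.1 hy.1).trans l)]⟩
  inf_le_left x y := ⟨inf_le_left, fun h => h.1⟩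
  inf_le_right x y := ⟨inf_le_right, fun h => h.2⟩
  le_inf x y z hy hz := ⟨le_inf hy.1 hz.1, fun h => ⟨hy.2 h, hz.2 h⟩⟩

/-- The projection of the doubled lattice onto the original one. -/
def proj (a b : L) : LatticeHom (DoubledInterval a b) L where
  toFun x := x.1.1
  map_sup' _ _ := rfl
  map_inf' _ _ := rfl

end DoubledInterval

/-- Whitman's condition, together with generation by elements that are join prime and meet
prime. -/
structure IsWhitmanLattice (L : Type u) [Lattice L] : Prop where
  whitman : ∀ a b c d : L, a ⊓ b ≤ c ⊔ d → a ≤ c ⊔ d ∨ b ≤ c ⊔ d ∨ a ⊓ b ≤ c ∨ a ⊓ b ≤ d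
  induction : ∀ p : L → Prop,
    (∀ x, (∀ a b, x ≤ a ⊔ b → x ≤ a ∨ x ≤ b) → (∀ a b, a ⊓ b ≤ x → a ≤ x ∨ b ≤ x) → p x) →
    (∀ a b, p a → p b → p (a ⊔ b)) → (∀ a b, p a → p b → p (a ⊓ b)) → ∀ a, p a

theorem IsWhitmanLattice.dual {L : Type u} [Lattice L] (h : IsWhitmanLattice L) :
    IsWhitmanLattice Lᵒᵈ where
  whitman a b c d hle := by
    have := h.whitman (ofDual c) (ofDual d) (ofDual a) (ofDual b) hle
    tauto
  induction p hx sup inf := h.induction (fun a => p (toDual a))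
    (fun x h₁ h₂ => hx (toDual x) h₂ h₁) inf sup

namespace FreeLattice

variable {X : Type u}

/-- Day's argument: if the condition fails, double the interval `[a ⊓ b, c ⊔ d]` and lift the
generators, with value false inside the interval. Then `a` and `b` lie above the interval and get
true, hence so does `a ⊓ b`; `c` and `d` are not above `a ⊓ b` and get false, hence so does `c ⊔ d`.
This contradicts monotonicity. -/
theorem whitman (a b c d : FreeLattice X) (hle : a ⊓ b ≤ c ⊔ d) :
    a ≤ c ⊔ d ∨ b ≤ c ⊔ d ∨ a ⊓ b ≤ c ∨ a ⊓ b ≤ d := by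
  by_contra! hne
  obtain ⟨ha, hb, hc, hd⟩ := hne
  let f : X → DoubledInterval (a ⊓ b) (c ⊔ d) := fun x =>
    ⟨(of x, a ⊓ b ≤ of x ∧ ¬ of x ≤ c ⊔ d), fun h => h.1, fun h k => ⟨h, k⟩⟩
  have hproj : (DoubledInterval.proj _ _).comp (lift f) = LatticeHom.id _ :=
    hom_ext fun _ => rfl
  have hfst (t : FreeLattice X) : (lift f t).1.1 = t := DFunLike.congr_fun hproj t
  have ha' : (lift f a).1.2 := (lift f a).2.2 (by simp [hfst]) (by rwa [hfst])
  have hb' : (lift f b).1.2 := (lift f b).2.2 (by simp [hfst]) (by rwa [hfst])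
  have hmono : lift f a ⊓ lift f b ≤ lift f c ⊔ lift f d := by
    rw [← map_inf, ← map_sup]
    exact OrderHomClass.mono _ hle
  obtain h | h | h := hmono.2 ⟨ha', hb'⟩
  · exact hc (by simpa [hfst] using (lift f c).2.1 h)
  · exact hd (by simpa [hfst] using (lift f d).2.1 h)
  · exact h.2 (by simp [hfst])

theorem of_le_sup (x : X) (a b : FreeLattice X) (hle : of x ≤ a ⊔ b) : of x ≤ a ∨ of x ≤ b := by
  -- The homomorphism to `Prop` that is true at `x` alone among the generators detects the elements
  -- above `of x`; joins in `Prop` are disjunctions, whence primeness.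
  have key : ∀ a, lift (fun y => y = x) a → of x ≤ a := by
    refine induction ?_ ?_ ?_
    · rintro y rfl
      exact le_rfl
    · intro a b ha hb h
      rw [map_sup] at h
      exact h.elim (fun h => le_sup_of_le_left (ha h)) fun h => le_sup_of_le_right (hb h)
    · intro a b ha hb h
      rw [map_inf] at h
      exact le_inf (ha h.1) (hb h.2)
  have h : lift (fun y => y = x) (a ⊔ b) :=
    (OrderHomClass.mono (lift fun y => y = x) hle : _ → _) (show x = x from rfl)
  rw [map_sup] at h
  exact h.imp (key a) (key b)

theorem inf_le_of (x : X) (a b : FreeLattice X) (hle : a ⊓ b ≤ of x) : a ≤ of x ∨ b ≤ of x := by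
  have key : ∀ a, ¬ lift (fun y => y ≠ x) a → a ≤ of x := by
    refine induction ?_ ?_ ?_
    · intro y h
      rw [not_not.1 h]
    · intro a b ha hb h
      rw [map_sup] at h
      exact sup_le (ha fun k => h (.inl k)) (hb fun k => h (.inr k))
    · intro a b ha hb h
      rw [map_inf] at h
      by_cases k : lift (fun y => y ≠ x) a
      · exact inf_le_of_right_le (hb fun l => h ⟨k, l⟩)
      · exact inf_le_of_left_le (ha k)
  by_contra! h
  have h' : lift (fun y => y ≠ x) (a ⊓ b) := by
    rw [map_inf]
    exact ⟨not_not.1 fun k => h.1 (key a k), not_not.1 fun k => h.2 (key b k)⟩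
  exact (OrderHomClass.mono (lift fun y => y ≠ x) hle : _ → _) h' rfl

theorem isWhitmanLattice (X : Type u) : IsWhitmanLattice (FreeLattice X) where
  whitman := whitman
  induction _ hx := induction fun x => hx _ (of_le_sup x) (inf_le_of x)

end FreeLattice

/-! ### Dean's condition for pairs -/

/-- Dean's condition for two-element sets. -/
def PairDeanCondition {D : Type u} [Lattice D] (P : Set D) : Prop :=
  ∀ a b c d : D, a ⊓ b ≤ c ⊔ d →
    a ≤ c ⊔ d ∨ b ≤ c ⊔ d ∨ a ⊓ b ≤ c ∨ a ⊓ b ≤ d ∨ ∃ p ∈ P, a ⊓ b ≤ p ∧ p ≤ c ⊔ d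

theorem DeanCondition.pair {D : Type u} [Lattice D] {P : Set D} (h : DeanCondition P) :
    PairDeanCondition P := by
  classical
  intro a b c d hle
  have hS (hne : ({a, b} : Finset D).Nonempty) : Finset.inf' {a, b} hne id = a ⊓ b := by simp
  have hT (hne : ({c, d} : Finset D).Nonempty) : Finset.sup' {c, d} hne id = c ⊔ d := by simp
  have := h {a, b} {c, d} (by simp) (by simp) (by rwa [hS, hT])
  rw [hS, hT] at this
  simp only [Finset.mem_insert, Finset.mem_singleton, exists_eq_or_imp, exists_eq_left] at this
  tauto

theorem PairDeanCondition.dual {D : Type u} [Lattice D] {P : Set D} (h : PairDeanCondition P) :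
    PairDeanCondition (ofDual ⁻¹' P : Set Dᵒᵈ) := by
  intro a b c d hle
  obtain h | h | h | h | ⟨p, hp, h₁, h₂⟩ := h (ofDual c) (ofDual d) (ofDual a) (ofDual b) hle
  · exact .inr (.inr (.inl h))
  · exact .inr (.inr (.inr (.inl h)))
  · exact .inl h
  · exact .inr (.inl h)
  · exact .inr (.inr (.inr (.inr ⟨toDual p, hp, h₂, h₁⟩)))

/-- A filter `Q` contains `{a | d ⊓ e ≤ s a}` as soon as it contains the generators in this set
and the sets `{a | q ≤ s a}` for `q = d`, `q = e` and the `q ∈ P` above `d ⊓ e`. -/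
theorem PairDeanCondition.filter_of_inf_le {A : Type u} {D : Type v} [Lattice A] [Lattice D]
    {P : Set D} (hP : PairDeanCondition P) {Z : Set A} (hZ : GeneratesLattice Z)
    (s : LatticeHom A D) {Q : A → Prop} (mono : ∀ a b, a ≤ b → Q a → Q b)
    (inf : ∀ a b, Q a → Q b → Q (a ⊓ b)) {d e : D} (hz : ∀ z ∈ Z, d ⊓ e ≤ s z → Q z)
    (hd : ∀ a, d ≤ s a → Q a) (he : ∀ a, e ≤ s a → Q a)
    (hp : ∀ p ∈ P, d ⊓ e ≤ p → ∀ a, p ≤ s a → Q a) : ∀ a, d ⊓ e ≤ s a → Q a := by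
  refine hZ.induction hz ?_ ?_
  · intro a b ha hb h
    rw [map_sup] at h
    obtain h | h | h | h | ⟨p, hpP, h₁, h₂⟩ := hP _ _ _ _ h
    · exact hd _ (by rwa [map_sup])
    · exact he _ (by rwa [map_sup])
    · exact mono _ _ le_sup_left (ha h)
    · exact mono _ _ le_sup_right (hb h)
    · exact hp p hpP h₁ _ (by rwa [map_sup])
  · intro a b ha hb h
    rw [map_inf, le_inf_iff] at h
    exact inf _ _ (ha h.1) (hb h.2)

/-- The dual of `PairDeanCondition.filter_of_inf_le`. -/
theorem PairDeanCondition.ideal_of_le_sup {A : Type u} {D : Type v} [Lattice A] [Lattice D]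
    {P : Set D} (hP : PairDeanCondition P) {Z : Set A} (hZ : GeneratesLattice Z)
    (s : LatticeHom A D) {Q : A → Prop} (anti : ∀ a b, b ≤ a → Q a → Q b)
    (sup : ∀ a b, Q a → Q b → Q (a ⊔ b)) {d e : D} (hz : ∀ z ∈ Z, s z ≤ d ⊔ e → Q z)
    (hd : ∀ a, s a ≤ d → Q a) (he : ∀ a, s a ≤ e → Q a)
    (hp : ∀ p ∈ P, p ≤ d ⊔ e → ∀ a, s a ≤ p → Q a) : ∀ a, s a ≤ d ⊔ e → Q a :=
  hP.dual.filter_of_inf_le hZ.dual (LatticeHom.dual s) (Q := fun a => Q (ofDual a))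
    (d := toDual d) (e := toDual e) anti sup hz hd he hp

/-! ### Homomorphisms into Whitman lattices are bounded -/

theorem IsWhitmanLattice.pairDeanCondition {L : Type u} [Lattice L] (h : IsWhitmanLattice L) :
    PairDeanCondition (∅ : Set L) := fun a b c d hle => by
  have := h.whitman a b c d hle
  tauto

/-- The existential over `hne` stands in for a missing top element: for empty `G` the filter
generated by `G` is empty. -/
theorem eq_empty_or_exists_isLeast_of_finset {A : Type u} {D : Type v} [Lattice A] [Lattice D]
    {s : LatticeHom A D} {d : D} (G : Finset A) (hG : ∀ z ∈ G, d ≤ s z)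
    (h : ∀ a, d ≤ s a → ∃ hne : G.Nonempty, G.inf' hne id ≤ a) :
    {x | d ≤ s x} = ∅ ∨ ∃ a, IsLeast {x | d ≤ s x} a := by
  obtain rfl | hne := G.eq_empty_or_nonempty
  · exact .inl (Set.eq_empty_of_forall_notMem fun a ha => by simpa using h a ha)
  · refine .inr ⟨G.inf' hne id, ?_, fun a ha => (h a ha).2⟩
    rw [Set.mem_ofPred_eq, map_finset_inf']
    exact Finset.le_inf' _ _ hG

theorem exists_finset_of_eq_empty_or_exists_isLeast {A : Type u} {S : Set A} [Lattice A]
    (h : S = ∅ ∨ ∃ a, IsLeast S a) :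
    ∃ M : Finset A, (∀ m ∈ M, m ∈ S) ∧ ∀ a ∈ S, ∃ m ∈ M, m ≤ a := by
  obtain rfl | ⟨a, ha⟩ := h
  · exact ⟨∅, by simp, by simp⟩
  · exact ⟨{a}, by simpa using ha.1, fun b hb => ⟨a, by simp, ha.2 hb⟩⟩

/-- Induction on the bound in `L`. For a prime generator the least preimage is the meet of the
generators of `A` sent above it; for `d ⊔ e` it is the join of those for `d` and `e`; for `d ⊓ e`,
by Whitman's condition, it is the meet of those for `d` and `e` (when they exist) and the generators
sent above `d ⊓ e`. -/
theorem IsWhitmanLattice.isLowerBoundedHom {A : Type u} {L : Type v} [Lattice A] [Lattice L]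
    (hL : IsWhitmanLattice L) (hA : FGLattice A) (s : LatticeHom A L) : IsLowerBoundedHom s := by
  classical
  obtain ⟨Z, hZ⟩ := hA
  have mono (G : Finset A) (a b : A) (hab : a ≤ b) :
      (∃ hne : G.Nonempty, G.inf' hne id ≤ a) → ∃ hne : G.Nonempty, G.inf' hne id ≤ b :=
    fun ⟨hne, h⟩ => ⟨hne, h.trans hab⟩
  have inf (G : Finset A) (a b : A) : (∃ hne : G.Nonempty, G.inf' hne id ≤ a) →
      (∃ hne : G.Nonempty, G.inf' hne id ≤ b) → ∃ hne : G.Nonempty, G.inf' hne id ≤ a ⊓ b :=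
    fun ⟨hne, h⟩ ⟨_, k⟩ => ⟨hne, le_inf h k⟩
  have mem {G : Finset A} {a : A} (ha : a ∈ G) : ∃ hne : G.Nonempty, G.inf' hne id ≤ a :=
    ⟨⟨a, ha⟩, Finset.inf'_le id ha⟩
  refine hL.induction _ ?_ ?_ ?_
  · intro x hx _
    refine eq_empty_or_exists_isLeast_of_finset (Z.filter (x ≤ s ·)) (by simp) ?_
    refine hZ.induction ?_ ?_ ?_
    · exact fun z hz h => mem (Finset.mem_filter.2 ⟨hz, h⟩)
    · intro a b ha hb h
      rw [map_sup] at h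
      exact (hx _ _ h).elim (fun h => mono _ _ _ le_sup_left (ha h))
        fun h => mono _ _ _ le_sup_right (hb h)
    · intro a b ha hb h
      rw [map_inf, le_inf_iff] at h
      exact inf _ _ _ (ha h.1) (hb h.2)
  · intro d e hd he
    obtain hd | ⟨a, ha⟩ := hd
    · exact .inl (Set.eq_empty_of_forall_notMem fun x hx =>
        (Set.eq_empty_iff_forall_notMem.1 hd) x (le_sup_left.trans hx))
    obtain he | ⟨b, hb⟩ := he
    · exact .inl (Set.eq_empty_of_forall_notMem fun x hx =>
        (Set.eq_empty_iff_forall_notMem.1 he) x (le_sup_right.trans hx))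
    refine .inr ⟨a ⊔ b, ?_, fun x hx =>
      sup_le (ha.2 (le_sup_left.trans hx)) (hb.2 (le_sup_right.trans hx))⟩
    rw [Set.mem_ofPred_eq, map_sup]
    exact sup_le_sup ha.1 hb.1
  · intro d e hd he
    obtain ⟨M, hM, hM'⟩ := exists_finset_of_eq_empty_or_exists_isLeast hd
    obtain ⟨N, hN, hN'⟩ := exists_finset_of_eq_empty_or_exists_isLeast he
    refine eq_empty_or_exists_isLeast_of_finset (Z.filter (d ⊓ e ≤ s ·) ∪ (M ∪ N)) ?_ ?_
    · intro z hz
      simp only [Finset.mem_union, Finset.mem_filter] at hz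
      obtain hz | hz | hz := hz
      exacts [hz.2, inf_le_left.trans (hM z hz), inf_le_right.trans (hN z hz)]
    refine hL.pairDeanCondition.filter_of_inf_le hZ s (mono _) (inf _) ?_ ?_ ?_ ?_
    · exact fun z hz h => mem (Finset.mem_union_left _ (Finset.mem_filter.2 ⟨hz, h⟩))
    · intro a ha
      obtain ⟨m, hm, hma⟩ := hM' a ha
      exact mono _ _ _ hma (mem (by simp [hm]))
    · intro a ha
      obtain ⟨m, hm, hma⟩ := hN' a ha
      exact mono _ _ _ hma (mem (by simp [hm]))
    · simp

theorem IsWhitmanLattice.isUpperBoundedHom {A : Type u} {L : Type v} [Lattice A] [Lattice L]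
    (hL : IsWhitmanLattice L) (hA : FGLattice A) (s : LatticeHom A L) : IsUpperBoundedHom s :=
  hL.dual.isLowerBoundedHom hA.dual (LatticeHom.dual s)

/-- If `D` is the image of a Whitman lattice under a lower bounded epimorphism, then every
homomorphism from a finitely generated lattice to `D` is lower bounded. -/
theorem IsWhitmanLattice.isLowerBoundedHom_of_surjective {L : Type u} {D : Type v} {A : Type w}
    [Lattice L] [Lattice D] [Lattice A] (hL : IsWhitmanLattice L) {f : LatticeHom L D}
    (hf : Function.Surjective f) (hfb : IsLowerBoundedHom f) (hA : FGLattice A)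
    (g : LatticeHom A D) : IsLowerBoundedHom g := by
  obtain ⟨Z, hZ⟩ := hA
  choose r hr using hf
  let π := FreeLattice.lift (Subtype.val : ↥(Z : Set A) → A)
  -- `g` itself need not factor through `f`, but `g.comp π` does. If `b` is least over `d` in `L`,
  -- the condition `d ≤ g (π w)` becomes `b ≤ s w`, where the Whitman case applies.
  let s : LatticeHom (FreeLattice ↥(Z : Set A)) L := FreeLattice.lift fun z => r (g z)
  have hcomp : f.comp s = g.comp π := FreeLattice.hom_ext fun z => hr _
  have hfs (w) : f (s w) = g (π w) := DFunLike.congr_fun hcomp w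
  have hπ : Function.Surjective π := FreeLattice.lift_surjective hZ
  intro d
  obtain h | ⟨b, hb⟩ := hfb d
  · exact absurd (show r d ∈ {x | d ≤ f x} from (hr d).ge) (by simp [h])
  have hiff (w) : b ≤ s w ↔ d ≤ g (π w) := by
    rw [← hfs]
    exact ⟨fun h => hb.1.trans (OrderHomClass.mono f h), fun h => hb.2 h⟩
  obtain h | ⟨w, hw⟩ := hL.isLowerBoundedHom (FreeLattice.fgLattice _) s b
  · refine .inl (Set.eq_empty_of_forall_notMem fun a ha => ?_)
    obtain ⟨w, rfl⟩ := hπ a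
    exact Set.eq_empty_iff_forall_notMem.1 h w ((hiff w).2 ha)
  · refine .inr ⟨π w, (hiff w).1 hw.1, fun a ha => ?_⟩
    obtain ⟨v, rfl⟩ := hπ a
    exact OrderHomClass.mono π (hw.2 ((hiff v).2 ha))

theorem IsWhitmanLattice.isUpperBoundedHom_of_surjective {L : Type u} {D : Type v} {A : Type w}
    [Lattice L] [Lattice D] [Lattice A] (hL : IsWhitmanLattice L) {f : LatticeHom L D}
    (hf : Function.Surjective f) (hfb : IsUpperBoundedHom f) (hA : FGLattice A)
    (g : LatticeHom A D) : IsUpperBoundedHom g :=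
  hL.dual.isLowerBoundedHom_of_surjective (f := LatticeHom.dual f) hf hfb hA.dual
    (LatticeHom.dual g)

/-- Variables are lifted indices rather than elements of `D`, so that `X` can be placed in any
universe. -/
theorem FGLattice.exists_surjective {D : Type u} [Lattice D] (hD : FGLattice D) :
    ∃ (X : Type v) (_ : Finite X) (f : LatticeHom (FreeLattice X) D),
      Function.Surjective f := by
  obtain ⟨P, hP⟩ := hD
  refine ⟨ULift (Fin P.card), inferInstance,
    FreeLattice.lift fun i => (P.equivFin.symm i.down).1, ?_⟩
  refine hP.induction ?_ ?_ ?_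
  · exact fun p hp => ⟨.of ⟨P.equivFin ⟨p, hp⟩⟩, by simp [FreeLattice.lift_of]⟩
  · rintro _ _ ⟨v, rfl⟩ ⟨w, rfl⟩
    exact ⟨v ⊔ w, map_sup _ _ _⟩
  · rintro _ _ ⟨v, rfl⟩ ⟨w, rfl⟩
    exact ⟨v ⊓ w, map_inf _ _ _⟩

/-- Transfers boundedness from `L` to a free lattice on finitely many variables in `Type`, as the
definition demands. -/
theorem IsWhitmanLattice.isBoundedLattice {L : Type u} {D : Type v} [Lattice L] [Lattice D]
    (hL : IsWhitmanLattice L) {f : LatticeHom L D} (hf : Function.Surjective f)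
    (hl : IsLowerBoundedHom f) (hu : IsUpperBoundedHom f) (hD : FGLattice D) :
    IsBoundedLattice D := by
  obtain ⟨X, hX, g, hg⟩ := hD.exists_surjective
  have hA := FreeLattice.fgLattice X
  exact ⟨⟨X, hX, g, hg, hL.isLowerBoundedHom_of_surjective hf hl hA g⟩,
    ⟨X, hX, g, hg, hL.isUpperBoundedHom_of_surjective hf hu hA g⟩⟩

/-! ### Boundedness from finite generation of fiber products -/

section FiberProduct

variable {A : Type u} {B : Type v} {D : Type w} [Lattice A] [Lattice B] [Lattice D]
  {g : LatticeHom A D} {h : LatticeHom B D}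

theorem mem_fiberProduct {c : A × B} : c ∈ fiberProduct g h ↔ g c.1 = h c.2 := Iff.rfl

theorem FGSublattice.exists_freeLattice {L : Type u} [Lattice L] {C : Sublattice L}
    (hC : FGSublattice C) : ∃ (Z : Type u) (_ : Finite Z) (f : LatticeHom (FreeLattice Z) L),
      ∀ c, c ∈ C ↔ ∃ w, f w = c := by
  obtain ⟨Z, hZ⟩ := hC
  refine ⟨(Z : Set L), inferInstance, FreeLattice.lift Subtype.val, fun c => ?_⟩
  rw [← SetLike.mem_coe, ← hZ, FreeLattice.mem_latticeClosure_iff_exists_lift]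

theorem isLowerBoundedHom_of_fgSublattice_fiberProduct (hB : IsWhitmanLattice B)
    (hg : Function.Surjective g) (hh : Function.Surjective h)
    (hC : FGSublattice (fiberProduct g h)) : IsLowerBoundedHom g := by
  obtain ⟨Z, _, f, hf⟩ := hC.exists_freeLattice
  have hs := hB.isLowerBoundedHom (FreeLattice.fgLattice Z) ((LatticeHom.snd (α := A) (β := B)).comp f)
  -- Joining `b` to any preimage of `g a` keeps it a preimage, so `a` has a partner above `b`.
  have lift (b : B) (a : A) (hab : h b ≤ g a) : ∃ w, b ≤ (f w).2 ∧ (f w).1 = a := by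
    obtain ⟨b', hb'⟩ := hh (g a)
    obtain ⟨w, hw⟩ := (hf (a, b' ⊔ b)).1 <| by
      rw [mem_fiberProduct, map_sup, hb', sup_eq_left.2 hab]
    exact ⟨w, by simp [hw], by rw [hw]⟩
  intro d
  obtain ⟨b, rfl⟩ := hh d
  obtain hemp | ⟨w, hw⟩ := hs b
  · obtain ⟨a, ha⟩ := hg (h b)
    obtain ⟨w, hw, -⟩ := lift b a ha.ge
    exact absurd hw (Set.eq_empty_iff_forall_notMem.1 hemp w)
  · refine .inr ⟨(f w).1, ?_, fun a ha => ?_⟩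
    · rw [Set.mem_ofPred_eq, mem_fiberProduct.1 ((hf _).2 ⟨w, rfl⟩)]
      exact OrderHomClass.mono h hw.1
    · obtain ⟨v, hv, rfl⟩ := lift b a ha
      exact (OrderHomClass.mono f (hw.2 hv)).1

theorem isUpperBoundedHom_of_fgSublattice_fiberProduct (hB : IsWhitmanLattice B)
    (hg : Function.Surjective g) (hh : Function.Surjective h)
    (hC : FGSublattice (fiberProduct g h)) : IsUpperBoundedHom g := by
  obtain ⟨Z, _, f, hf⟩ := hC.exists_freeLattice
  have hs := hB.isUpperBoundedHom (FreeLattice.fgLattice Z) ((LatticeHom.snd (α := A) (β := B)).comp f)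
  have lift (b : B) (a : A) (hab : g a ≤ h b) : ∃ w, (f w).2 ≤ b ∧ (f w).1 = a := by
    obtain ⟨b', hb'⟩ := hh (g a)
    obtain ⟨w, hw⟩ := (hf (a, b' ⊓ b)).1 <| by
      rw [mem_fiberProduct, map_inf, hb', inf_eq_left.2 hab]
    exact ⟨w, by simp [hw], by rw [hw]⟩
  intro d
  obtain ⟨b, rfl⟩ := hh d
  obtain hemp | ⟨w, hw⟩ := hs b
  · obtain ⟨a, ha⟩ := hg (h b)
    obtain ⟨w, hw, -⟩ := lift b a ha.le
    exact absurd hw (Set.eq_empty_iff_forall_notMem.1 hemp w)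
  · refine .inr ⟨(f w).1, ?_, fun a ha => ?_⟩
    · rw [Set.mem_ofPred_eq, mem_fiberProduct.1 ((hf _).2 ⟨w, rfl⟩)]
      exact OrderHomClass.mono h hw.1
    · obtain ⟨v, hv, rfl⟩ := lift b a ha
      exact (OrderHomClass.mono f (hw.2 hv)).1

theorem isBoundedLattice_of_fgSublattice_fiberProduct (hD : FGLattice D)
    (hA : IsWhitmanLattice A) (hB : IsWhitmanLattice B)
    (hg : Function.Surjective g) (hh : Function.Surjective h)
    (hC : FGSublattice (fiberProduct g h)) : IsBoundedLattice D :=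
  hA.isBoundedLattice hg (isLowerBoundedHom_of_fgSublattice_fiberProduct hB hg hh hC)
    (isUpperBoundedHom_of_fgSublattice_fiberProduct hB hg hh hC) hD

/-! ### Finite generation of fiber products from boundedness -/

/-- Surjectivity excludes the empty alternative, so the least elements form a lower adjoint. -/
theorem IsLowerBoundedHom.exists_galoisConnection (hb : IsLowerBoundedHom g)
    (hg : Function.Surjective g) : ∃ β : D → A, GaloisConnection β g := by
  have hex (d : D) : ∃ a, IsLeast {x | d ≤ g x} a := (hb d).resolve_left fun h => by
    obtain ⟨a, ha⟩ := hg d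
    exact Set.eq_empty_iff_forall_notMem.1 h a ha.ge
  choose β hβ using hex
  exact ⟨β, fun d a => ⟨fun h => (hβ d).1.trans (OrderHomClass.mono g h), fun h => (hβ d).2 h⟩⟩

theorem IsUpperBoundedHom.exists_galoisConnection (hb : IsUpperBoundedHom g)
    (hg : Function.Surjective g) : ∃ α : D → A, GaloisConnection g α := by
  have hex (d : D) : ∃ a, IsGreatest {x | g x ≤ d} a := (hb d).resolve_left fun h => by
    obtain ⟨a, ha⟩ := hg d
    exact Set.eq_empty_iff_forall_notMem.1 h a ha.le
  choose α hα using hex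
  exact ⟨α, fun a d => ⟨fun h => (hα d).2 h, fun h => (OrderHomClass.mono g h).trans (hα d).1⟩⟩

/-- A sublattice `R` of `A × B` contains all pairs `(β d, α d)` if it contains those for
generators `d` and the pairs `(x, α (g x))` and `(β (h y), y)` for generators `x`, `y`. -/
theorem PairDeanCondition.rel_lower_upper {P : Set D} (hP : PairDeanCondition P)
    (hPgen : GeneratesLattice P) {X : Set A} (hX : GeneratesLattice X) {Y : Set B}
    (hY : GeneratesLattice Y) {β : D → A} {α : D → B} (hβ : GaloisConnection β g)
    (hα : GaloisConnection h α) {R : A → B → Prop}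
    (sup : ∀ a a' b b', R a b → R a' b' → R (a ⊔ a') (b ⊔ b'))
    (inf : ∀ a a' b b', R a b → R a' b' → R (a ⊓ a') (b ⊓ b'))
    (hRX : ∀ x ∈ X, R x (α (g x))) (hRY : ∀ y ∈ Y, R (β (h y)) y)
    (hRP : ∀ p ∈ P, R (β p) (α p)) : ∀ d, R (β d) (α d) := by
  refine hPgen.induction hRP ?_ ?_
  · intro d e hd he
    -- The join of the pairs for `d` and `e` has the right first coordinate, as `β` preserves joins,
    -- but its second may be too small. A pair in `R` with second coordinate `α (d ⊔ e)` and first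
    -- at most `β (d ⊔ e)` repairs it. The `b` admitting such a pair form an ideal, so Dean's
    -- condition applies; the repair is the case `b = α (d ⊔ e)`.
    have key : ∀ b, h b ≤ d ⊔ e → ∃ a c, R a c ∧ b ≤ c ∧ c ≤ α (d ⊔ e) ∧ a ≤ β (d ⊔ e) := by
      have diag (q : D) (hq : q ≤ d ⊔ e) (hRq : R (β q) (α q)) (b : B) (hb : h b ≤ q) :
          ∃ a c, R a c ∧ b ≤ c ∧ c ≤ α (d ⊔ e) ∧ a ≤ β (d ⊔ e) :=
        ⟨_, _, hRq, (hα _ _).1 hb, hα.monotone_u hq, hβ.monotone_l hq⟩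
      refine hP.ideal_of_le_sup hY h ?_ ?_ ?_ (diag d le_sup_left hd) (diag e le_sup_right he)
        fun p hp hle => diag p hle (hRP p hp)
      · exact fun b b' hle ⟨a, c, hR, h₁, h₂⟩ => ⟨a, c, hR, hle.trans h₁, h₂⟩
      · exact fun b b' ⟨a, c, hR, h₁, h₂, h₃⟩ ⟨a', c', hR', h₁', h₂', h₃'⟩ =>
          ⟨_, _, sup _ _ _ _ hR hR', sup_le_sup h₁ h₁', sup_le h₂ h₂', sup_le h₃ h₃'⟩
      · exact fun y hy hle => ⟨_, _, hRY y hy, le_rfl, (hα _ _).1 hle, hβ.monotone_l hle⟩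
    obtain ⟨a, c, hR, h₁, h₂, h₃⟩ := key (α (d ⊔ e)) (hα.l_u_le _)
    have := sup _ _ _ _ hR (sup _ _ _ _ hd he)
    rwa [← hβ.l_sup, le_antisymm h₂ h₁, sup_eq_right.2 h₃, sup_eq_left.2
      (sup_le (hα.monotone_u le_sup_left) (hα.monotone_u le_sup_right))] at this
  · intro d e hd he
    have key : ∀ a, d ⊓ e ≤ g a → ∃ c b, R c b ∧ c ≤ a ∧ β (d ⊓ e) ≤ c ∧ α (d ⊓ e) ≤ b := by
      have diag (q : D) (hq : d ⊓ e ≤ q) (hRq : R (β q) (α q)) (a : A) (ha : q ≤ g a) :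
          ∃ c b, R c b ∧ c ≤ a ∧ β (d ⊓ e) ≤ c ∧ α (d ⊓ e) ≤ b :=
        ⟨_, _, hRq, (hβ _ _).2 ha, hβ.monotone_l hq, hα.monotone_u hq⟩
      refine hP.filter_of_inf_le hX g ?_ ?_ ?_ (diag d inf_le_left hd) (diag e inf_le_right he)
        fun p hp hle => diag p hle (hRP p hp)
      · exact fun a a' hle ⟨c, b, hR, h₁, h₂⟩ => ⟨c, b, hR, h₁.trans hle, h₂⟩
      · exact fun a a' ⟨c, b, hR, h₁, h₂, h₃⟩ ⟨c', b', hR', h₁', h₂', h₃'⟩ =>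
          ⟨_, _, inf _ _ _ _ hR hR', inf_le_inf h₁ h₁', le_inf h₂ h₂', le_inf h₃ h₃'⟩
      · exact fun x hx hle => ⟨_, _, hRX x hx, le_rfl, (hβ _ _).2 hle, hα.monotone_u hle⟩
    obtain ⟨c, b, hR, h₁, h₂, h₃⟩ := key (β (d ⊓ e)) (hβ.le_u_l _)
    have := inf _ _ _ _ hR (inf _ _ _ _ hd he)
    rwa [← hα.u_inf, le_antisymm h₁ h₂, inf_eq_right.2 h₃, inf_eq_left.2
      (le_inf (hβ.monotone_l inf_le_left) (hβ.monotone_l inf_le_right))] at this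

/-- A sublattice `R` of `A × B` that contains all pairs `(βg d, αh d)` and `(αg d, βh d)`, and
the pairs `(x, αh (g x))` and `(x, βh (g x))` for generators `x`, contains them for all `x`. -/
theorem rel_upper_and_rel_lower {X : Set A} (hX : GeneratesLattice X)
    (hh : Function.Surjective h) {βg αg : D → A} {βh αh : D → B} (hβg : GaloisConnection βg g)
    (hαg : GaloisConnection g αg) (hβh : GaloisConnection βh h) (hαh : GaloisConnection h αh)
    {R : A → B → Prop} (sup : ∀ a a' b b', R a b → R a' b' → R (a ⊔ a') (b ⊔ b'))
    (inf : ∀ a a' b b', R a b → R a' b' → R (a ⊓ a') (b ⊓ b'))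
    (hRα : ∀ x ∈ X, R x (αh (g x))) (hRβ : ∀ x ∈ X, R x (βh (g x)))
    (hβα : ∀ d, R (βg d) (αh d)) (hαβ : ∀ d, R (αg d) (βh d)) :
    ∀ a, R a (αh (g a)) ∧ R a (βh (g a)) := by
  have hle (d) : βh d ≤ αh d := by
    obtain ⟨b, rfl⟩ := hh d
    exact (hβh.l_u_le b).trans (hαh.le_u_l b)
  refine hX.induction (fun x hx => ⟨hRα x hx, hRβ x hx⟩) ?_ ?_
  · rintro a b ⟨-, ha⟩ ⟨-, hb⟩
    have hβ : R (a ⊔ b) (βh (g (a ⊔ b))) := by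
      rw [map_sup, hβh.l_sup]
      exact sup _ _ _ _ ha hb
    refine ⟨?_, hβ⟩
    -- Since `βg (g x) ≤ x`, this join leaves the first coordinate alone and raises the second from
    -- `βh` to `αh`.
    have := sup _ _ _ _ hβ (hβα (g (a ⊔ b)))
    rwa [sup_eq_left.2 (hβg.l_u_le _), sup_eq_right.2 (hle _)] at this
  · rintro a b ⟨ha, -⟩ ⟨hb, -⟩
    have hα : R (a ⊓ b) (αh (g (a ⊓ b))) := by
      rw [map_inf, hαh.u_inf]
      exact inf _ _ _ _ ha hb
    refine ⟨hα, ?_⟩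
    have := inf _ _ _ _ hα (hαβ (g (a ⊓ b)))
    rwa [inf_eq_left.2 (hαg.le_u_l _), inf_eq_right.2 (hle _)] at this

theorem fgSublattice_fiberProduct_of_bounded {P : Finset D}
    (hPgen : GeneratesLattice (P : Set D)) (hP : PairDeanCondition (P : Set D))
    (hA : FGLattice A) (hB : FGLattice B) (hg : Function.Surjective g)
    (hh : Function.Surjective h) (hgl : IsLowerBoundedHom g) (hgu : IsUpperBoundedHom g)
    (hhl : IsLowerBoundedHom h) (hhu : IsUpperBoundedHom h) :
    FGSublattice (fiberProduct g h) := by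
  classical
  obtain ⟨X, hX⟩ := hA
  obtain ⟨Y, hY⟩ := hB
  obtain ⟨βg, hβg⟩ := hgl.exists_galoisConnection hg
  obtain ⟨αg, hαg⟩ := hgu.exists_galoisConnection hg
  obtain ⟨βh, hβh⟩ := hhl.exists_galoisConnection hh
  obtain ⟨αh, hαh⟩ := hhu.exists_galoisConnection hh
  have gβ (d : D) : g (βg d) = d := by
    obtain ⟨a, rfl⟩ := hg d
    exact hβg.u_l_u_eq_u a
  have gα (d : D) : g (αg d) = d := by
    obtain ⟨a, rfl⟩ := hg d
    exact hαg.l_u_l_eq_l a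
  have hβ (d : D) : h (βh d) = d := by
    obtain ⟨b, rfl⟩ := hh d
    exact hβh.u_l_u_eq_u b
  have hα (d : D) : h (αh d) = d := by
    obtain ⟨b, rfl⟩ := hh d
    exact hαh.l_u_l_eq_l b
  -- Both extreme partners of each generator of `A` and of `B`, and the two opposite extreme pairs
  -- over each `p ∈ P`.
  let Z : Finset (A × B) :=
    X.image (fun x => (x, αh (g x))) ∪ X.image (fun x => (x, βh (g x))) ∪
      Y.image (fun y => (αg (h y), y)) ∪ Y.image (fun y => (βg (h y), y)) ∪
      P.image (fun p => (βg p, αh p)) ∪ P.image (fun p => (αg p, βh p))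
  have mem {c : A × B} (hc : c ∈ Z) : c ∈ latticeClosure (Z : Set (A × B)) :=
    subset_latticeClosure hc
  have sup (a a' : A) (b b' : B) (hc : (a, b) ∈ latticeClosure (Z : Set (A × B)))
      (hc' : (a', b') ∈ latticeClosure (Z : Set (A × B))) :
      (a ⊔ a', b ⊔ b') ∈ latticeClosure (Z : Set (A × B)) :=
    isSublattice_latticeClosure.supClosed hc hc'
  have inf (a a' : A) (b b' : B) (hc : (a, b) ∈ latticeClosure (Z : Set (A × B)))
      (hc' : (a', b') ∈ latticeClosure (Z : Set (A × B))) :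
      (a ⊓ a', b ⊓ b') ∈ latticeClosure (Z : Set (A × B)) :=
    isSublattice_latticeClosure.infClosed hc hc'
  have hXα (x) (hx : x ∈ X) := mem (c := (x, αh (g x))) (by
    have := Finset.mem_image_of_mem (fun x => (x, αh (g x))) hx
    simp only [Z, Finset.mem_union]
    tauto)
  have hXβ (x) (hx : x ∈ X) := mem (c := (x, βh (g x))) (by
    have := Finset.mem_image_of_mem (fun x => (x, βh (g x))) hx
    simp only [Z, Finset.mem_union]
    tauto)
  have hYα (y) (hy : y ∈ Y) := mem (c := (αg (h y), y)) (by
    have := Finset.mem_image_of_mem (fun y => (αg (h y), y)) hy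
    simp only [Z, Finset.mem_union]
    tauto)
  have hYβ (y) (hy : y ∈ Y) := mem (c := (βg (h y), y)) (by
    have := Finset.mem_image_of_mem (fun y => (βg (h y), y)) hy
    simp only [Z, Finset.mem_union]
    tauto)
  have hPβα (p) (hp : p ∈ P) := mem (c := (βg p, αh p)) (by
    have := Finset.mem_image_of_mem (fun p => (βg p, αh p)) hp
    simp only [Z, Finset.mem_union]
    tauto)
  have hPαβ (p) (hp : p ∈ P) := mem (c := (αg p, βh p)) (by
    have := Finset.mem_image_of_mem (fun p => (αg p, βh p)) hp
    simp only [Z, Finset.mem_union]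
    tauto)
  refine ⟨Z, (latticeClosure_min ?_ (fiberProduct g h).isSublattice).antisymm ?_⟩
  · intro c hc
    simp only [Z, Finset.coe_union, Finset.coe_image, Set.mem_union, Set.mem_image] at hc
    obtain ((((⟨x, -, rfl⟩ | ⟨x, -, rfl⟩) | ⟨y, -, rfl⟩) | ⟨y, -, rfl⟩) | ⟨p, -, rfl⟩) |
      ⟨p, -, rfl⟩ := hc <;> simp [mem_fiberProduct, gβ, gα, hβ, hα]
  · rintro ⟨a, b⟩ hab
    replace hab : g a = h b := hab
    have hβα := hP.rel_lower_upper hPgen hX hY hβg hαh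
      (R := fun a b => (a, b) ∈ latticeClosure (Z : Set (A × B))) sup inf hXα hYβ hPβα
    have hαβ := hP.rel_lower_upper hPgen hY hX hβh hαg
      (R := fun b a => (a, b) ∈ latticeClosure (Z : Set (A × B)))
      (fun b b' a a' => sup a a' b b') (fun b b' a a' => inf a a' b b') hYα hXβ hPαβ
    have ha := (rel_upper_and_rel_lower hX hh hβg hαg hβh hαh
      (R := fun a b => (a, b) ∈ latticeClosure (Z : Set (A × B)))
      sup inf hXα hXβ hβα hαβ a).2
    have hb := (rel_upper_and_rel_lower hY hg hβh hαh hβg hαg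
      (R := fun b a => (a, b) ∈ latticeClosure (Z : Set (A × B)))
      (fun b b' a a' => sup a a' b b') (fun b b' a a' => inf a a' b b') hYα hYβ hαβ hβα b).2
    -- The lower adjoint coordinates are absorbed: `βg (g a) ≤ a` and `βh (h b) ≤ b`.
    have := sup _ _ _ _ ha hb
    rwa [← hab, sup_eq_left.2 (hβg.l_u_le a), hab, sup_eq_right.2 (hβh.l_u_le b)] at this

/-- Fiber products over a bounded lattice with Dean's condition are finitely generated. -/
theorem IsBoundedLattice.fgSublattice_fiberProduct (hD : IsBoundedLattice D) {P : Finset D}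
    (hPgen : GeneratesLattice (P : Set D)) (hP : DeanCondition (P : Set D))
    (hA : FGLattice A) (hB : FGLattice B) (hg : Function.Surjective g)
    (hh : Function.Surjective h) : FGSublattice (fiberProduct g h) := by
  obtain ⟨⟨X, _, f, hf, hl⟩, Y, _, f', hf', hu⟩ := hD
  have hX := FreeLattice.isWhitmanLattice X
  have hY := FreeLattice.isWhitmanLattice Y
  exact fgSublattice_fiberProduct_of_bounded hPgen hP.pair hA hB hg hh
    (hX.isLowerBoundedHom_of_surjective hf hl hA g) (hY.isUpperBoundedHom_of_surjective hf' hu hA g)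
    (hX.isLowerBoundedHom_of_surjective hf hl hB h) (hY.isUpperBoundedHom_of_surjective hf' hu hB h)

end FiberProduct

theorem corollary1p4 {D : Type u} [Lattice D] (P : Finset D)
    (hgen : GeneratesLattice (P : Set D)) (hDean : DeanCondition (P : Set D)) :
    List.TFAE [
      IsBoundedLattice D,
      ∃ (X : Type) (_ : Finite X) (h : LatticeHom (FreeLattice X) D),
        Function.Surjective h ∧ FGSublattice (latticeKer h),
      ∀ (A : Type v) [Lattice A], FGLattice A → ∀ g : LatticeHom A D,
        Function.Surjective g → FGSublattice (latticeKer g),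
      ∀ (A : Type v) (B : Type w) [Lattice A] [Lattice B], FGLattice A → FGLattice B →
        ∀ (g : LatticeHom A D) (h : LatticeHom B D),
          Function.Surjective g → Function.Surjective h →
            FGSublattice (fiberProduct g h)] := by
  have hD : FGLattice D := ⟨P, hgen⟩
  tfae_have 1 → 3 := fun h A _ hA g hg => h.fgSublattice_fiberProduct hgen hDean hA hA hg hg
  tfae_have 1 → 4 := fun h A B _ _ hA hB g h' hg hh =>
    h.fgSublattice_fiberProduct hgen hDean hA hB hg hh
  tfae_have 1 → 2 := by
    intro h
    obtain ⟨X, hX, f, hf⟩ := hD.exists_surjective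
    have hA := FreeLattice.fgLattice X
    exact ⟨X, hX, f, hf, h.fgSublattice_fiberProduct hgen hDean hA hA hf hf⟩
  tfae_have 2 → 1 := by
    rintro ⟨X, -, f, hf, hC⟩
    have hX := FreeLattice.isWhitmanLattice X
    exact isBoundedLattice_of_fgSublattice_fiberProduct hD hX hX hf hf hC
  tfae_have 3 → 1 := by
    intro h
    obtain ⟨X, _, f, hf⟩ := hD.exists_surjective
    have hX := FreeLattice.isWhitmanLattice X
    exact isBoundedLattice_of_fgSublattice_fiberProduct hD hX hX hf hf
      (h _ (FreeLattice.fgLattice X) f hf)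
  tfae_have 4 → 1 := by
    intro h
    obtain ⟨X, _, f, hf⟩ := hD.exists_surjective
    -- A second free lattice is needed because `A` and `B` range over different universes.
    obtain ⟨Y, _, f', hf'⟩ := hD.exists_surjective
    exact isBoundedLattice_of_fgSublattice_fiberProduct hD (FreeLattice.isWhitmanLattice X)
      (FreeLattice.isWhitmanLattice Y) hf hf'
      (h _ _ (FreeLattice.fgLattice X) (FreeLattice.fgLattice Y) f f' hf hf')
  tfae_finish
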